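/- Let $\mathcal{E}$ be an elementary topos (finite limits, cartesian closed, with a subobject classifier) with chosen terminal object $1$ and binary products. Let $(\Sigma,E)$ be a variety: a set $\Sigma$ of operation symbols of finite arity and a set $E$ of equations between $\Sigma$-terms in finitely many variables; a $(\Sigma,E)$-algebra in $\mathcal{E}$ is an object $A$ with a morphism $\sigma_A : A^n \to A$ for each $n$-ary $\sigma\in\Sigma$, satisfying the equations in $E$. Let $(Q,\otimes,k,\le)$ be an internal partially ordered commutative monoid in $\mathcal{E}$ (a commutative monoid object with an internal partial order for which $\otimes$ is monotone). An algebraic $Q$-span $A\to B$ between $(\Sigma,E)$-algebras is a quadruple $(X,f,g,\chi)$ of an object $X$ and morphisms $f:X\to A$, $g:X\to B$, $\chi:X\to Q$ of $\mathcal{E}$ such that for every $n$-ary $\sigma\in\Sigma$ the following holds in the internal language of $\mathcal{E}$: $$\forall x_1,\dots,x_n\in X\ \exists x\in X:\quad f(x)=\sigma(f(x_1),\dots,f(x_n)),\quad g(x)=\sigma(g(x_1),\dots,g(x_n)),\quad \chi(x_1)\otimes\dots\otimes\chi(x_n)\le\chi(x).$$ Two such spans $(X,f,g,\chi)$ and $(X',f',g',\chi')$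 are isomorphic if there is an isomorphism $i:X\to X'$ with $f=f'\circ i$, $g=g'\circ i$, $\chi=\chi'\circ i$. Let $\mathrm{Span}_{(\Sigma,E)}(Q)$ be the category whose objects are the $(\Sigma,E)$-algebras in $\mathcal{E}$ and whose morphisms are the isomorphism classes of algebraic $Q$-spans. The composite of $(X,f,g,\chi):A\to B$ and $(Y,h,l,\xi):B\to C$ is the pullback span with apex $X\times_B Y$ and characteristic morphism $(x,y)\mapsto\chi(x)\otimes\xi(y)$; the identity on $A$ is $(A,1_A,1_A,\chi_k)$, where $\chi_k$ is the constant morphism $A\to 1\xrightarrow{k}Q$. For a homomorphism $f:A\to B$ its graph is $f_\circ=(A,1_A,f,\chi_k)$, and the converse of $R=(X,f,g,\chi)$ is $R^\circ=(X,g,f,\chi)$. The symmetric monoidal structure on $\mathrm{Span}_{(\Sigma,E)}(Q)$ is inherited from finite products: the unit is the terminal algebra, the tensor of algebras is their product, the tensor of $(X,f,g,\chi)$ and $(X',f',g',\chi')$ is $(X\times X',f\times f',g\times g',(x,x')\mapsto\chi(x)\otimes\chi'(x'))$, and the coherence isomorphisms are the graphs of those for products of algebras. A hypergraph category is a symmetric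 monoidal category with, on every object $A$, a commutative monoid $(\eta_A,\mu_A)$ and a cocommutative comonoid $(\epsilon_A,\delta_A)$ satisfying the Frobenius axiom $(\mu\otimes 1)(1\otimes\delta)=\delta\mu=(1\otimes\mu)(\delta\otimes 1)$ and the special axiom $\mu\delta=1$, coherently with the monoidal structure: the structure on $A\otimes B$ is obtained from those on $A$ and $B$ via the symmetry, and the structure on the monoidal unit is the canonical one. Then $\mathrm{Span}_{(\Sigma,E)}(Q)$ is a hypergraph category, with comonoid structure on each algebra $A$ given by the graphs of the canonical homomorphisms $!:A\to 1$ and $\langle 1_A,1_A\rangle:A\to A\times A$, $$\epsilon_A=(!)_\circ,\qquad \delta_A=\langle 1_A,1_A\rangle_\circ,$$ and monoid structure given by their converses, $$\eta_A=((!)_\circ)^\circ,\qquad \mu_A=(\langle 1_A,1_A\rangle_\circ)^\circ .$$ -/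

import Mathlib

open CategoryTheory MonoidalCategory CartesianMonoidalCategory Limits
open scoped MonObj

universe w v u

-- Otherwise `⟶` elaborates through reflexive quivers, which hinders rewriting.
attribute [-instance] CategoryTheory.catToReflQuiver

noncomputable section

namespace AlgQSpan

/-! ### Hypergraph categories -/

/-- A hypergraph structure on a symmetric monoidal category: every object carries a commutative
monoid and a cocommutative comonoid satisfying the Frobenius and special axioms, and the choice is
coherent with the monoidal structure. -/
structure HypergraphStructure (C : Type u) [Category.{v} C] [MonoidalCategory C]
    [SymmetricCategory C] where
  mon (A : C) : MonObj A
  mon_comm (A : C) : letI := mon A; IsCommMonObj A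
  comon (A : C) : ComonObj A
  comon_comm (A : C) : letI := comon A; IsCommComonObj A
  /-- The Frobenius axiom, first half. -/
  frobenius_left (A : C) :
    A ◁ (comon A).comul ≫ (α_ A A A).inv ≫ (mon A).mul ▷ A = (mon A).mul ≫ (comon A).comul
  /-- The Frobenius axiom, second half. -/
  frobenius_right (A : C) :
    (comon A).comul ▷ A ≫ (α_ A A A).hom ≫ A ◁ (mon A).mul = (mon A).mul ≫ (comon A).comul
  /-- The special axiom. -/
  special (A : C) : (comon A).comul ≫ (mon A).mul = 𝟙 A
  /-- Coherence of the comonoids with the tensor product. -/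
  comul_tensor (A B : C) :
    (comon (A ⊗ B)).comul = ((comon A).comul ⊗ₘ (comon B).comul) ≫ tensorμ A A B B
  counit_tensor (A B : C) :
    (comon (A ⊗ B)).counit = ((comon A).counit ⊗ₘ (comon B).counit) ≫ (λ_ (𝟙_ C)).hom
  /-- Coherence of the monoids with the tensor product. -/
  mul_tensor (A B : C) :
    (mon (A ⊗ B)).mul = tensorμ A B A B ≫ ((mon A).mul ⊗ₘ (mon B).mul)
  one_tensor (A B : C) :
    (mon (A ⊗ B)).one = (λ_ (𝟙_ C)).inv ≫ ((mon A).one ⊗ₘ (mon B).one)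
  /-- Coherence with the unit object. -/
  comul_unit : (comon (𝟙_ C)).comul = (λ_ (𝟙_ C)).inv
  counit_unit : (comon (𝟙_ C)).counit = 𝟙 (𝟙_ C)
  mul_unit : (mon (𝟙_ C)).mul = (λ_ (𝟙_ C)).hom
  one_unit : (mon (𝟙_ C)).one = 𝟙 (𝟙_ C)

/-! ### Varieties and their algebras -/

/-- A presentation of a variety: a set of operation symbols of finite arity (a first-order language
without relation symbols), and a set of equations, each a pair of terms over a finite list of
variables. -/
structure Variety where
  lang : FirstOrder.Language.{w, 0}
  isAlgebraic : lang.IsAlgebraic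
  eqs : Set (Σ n : ℕ, lang.Term (Fin n) × lang.Term (Fin n))

section Algebras

variable {E : Type u} [Category.{v} E] [HasFiniteProducts E]

/-- The power `Aⁿ`. -/
abbrev pow (A : E) (n : ℕ) : E := ∏ᶜ fun _ : Fin n => A

lemma comp_piLift {T T' X : E} (e : T' ⟶ T) {n : ℕ} (a : Fin n → (T ⟶ X)) :
    e ≫ Pi.lift a = Pi.lift (fun i => e ≫ a i) := by ext; simp

/-- The interpretation `Aᵐ ⟶ A` of a term in `m` variables. -/
def interp {L : FirstOrder.Language.{w, 0}} {A : E}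
    (op : ∀ {n : ℕ}, L.Functions n → (pow A n ⟶ A)) {m : ℕ} :
    L.Term (Fin m) → (pow A m ⟶ A)
  | .var i => Pi.π _ i
  | .func σ ts => Pi.lift (fun i => interp op (ts i)) ≫ op σ

variable (V : Variety.{w}) (E)

/-- An algebra of the variety `V` in `E`. -/
structure Alg where
  carrier : E
  op : ∀ {n : ℕ}, V.lang.Functions n → (pow carrier n ⟶ carrier)
  sat : ∀ e ∈ V.eqs, interp op e.2.1 = interp op e.2.2

variable {V E}

namespace Alg

/-- A morphism of carriers is a homomorphism if it commutes with the operations. -/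
def IsHom (A B : Alg E V) (f : A.carrier ⟶ B.carrier) : Prop :=
  ∀ ⦃n : ℕ⦄ (σ : V.lang.Functions n), A.op σ ≫ f = Limits.Pi.map (fun _ => f) ≫ B.op σ

lemma IsHom.id (A : Alg E V) : IsHom A A (𝟙 _) := fun _ _ => by simp

lemma IsHom.comp {A B C : Alg E V} {f : A.carrier ⟶ B.carrier} {g : B.carrier ⟶ C.carrier}
    (hf : IsHom A B f) (hg : IsHom B C g) : IsHom A C (f ≫ g) := fun _ σ => by
  rw [← Category.assoc, hf, Category.assoc, hg, ← Category.assoc]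
  congr 1
  ext
  simp

/-- Homomorphisms of algebras. -/
@[ext]
structure Hom (A B : Alg E V) where
  hom : A.carrier ⟶ B.carrier
  isHom : IsHom A B hom

instance : Category (Alg E V) where
  Hom := Hom
  id A := ⟨𝟙 _, .id A⟩
  comp f g := ⟨f.hom ≫ g.hom, f.isHom.comp g.isHom⟩

@[ext]
lemma hom_ext {A B : Alg E V} {f g : A ⟶ B} (h : f.hom = g.hom) : f = g := Hom.ext h

@[simp] lemma id_hom (A : Alg E V) : (𝟙 A : A ⟶ A).hom = 𝟙 A.carrier := rfl

@[simp] lemma comp_hom {A B C : Alg E V} (f : A ⟶ B) (g : B ⟶ C) :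
    (f ≫ g).hom = f.hom ≫ g.hom := rfl

lemma interp_hom {L : FirstOrder.Language.{w, 0}} {A B : E}
    (opA : ∀ {n : ℕ}, L.Functions n → (pow A n ⟶ A))
    (opB : ∀ {n : ℕ}, L.Functions n → (pow B n ⟶ B)) (f : A ⟶ B)
    (hf : ∀ {n : ℕ} (σ : L.Functions n), opA σ ≫ f = Limits.Pi.map (fun _ => f) ≫ opB σ) {m : ℕ}
    (t : L.Term (Fin m)) :
    interp opA t ≫ f = Limits.Pi.map (fun _ => f) ≫ interp opB t := by
  induction t with
  | var i => simp [interp]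
  | func σ ts ih =>
    simp only [interp, Category.assoc, hf]
    simp only [← Category.assoc]
    congr 1
    ext i
    simp [ih]

/-- An isomorphism of algebras from an isomorphism of carriers. -/
def mkIso {A B : Alg E V} (e : A.carrier ≅ B.carrier) (h : IsHom A B e.hom)
    (h' : IsHom B A e.inv) : A ≅ B where
  hom := ⟨e.hom, h⟩
  inv := ⟨e.inv, h'⟩
  hom_inv_id := by ext; exact e.hom_inv_id
  inv_hom_id := by ext; exact e.inv_hom_id

end Alg

end Algebras

/-! ### Finite products of algebras -/

namespace Alg

variable {E : Type u} [Category.{v} E] [CartesianMonoidalCategory E] {V : Variety.{w}}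

/-- The terminal algebra. -/
def unit : Alg E V where
  carrier := 𝟙_ E
  op _ := toUnit _
  sat _ _ := toUnit_unique _ _

/-- The product of two algebras; its operations are computed componentwise. -/
def prod (A B : Alg E V) : Alg E V where
  carrier := A.carrier ⊗ B.carrier
  op σ := lift (Limits.Pi.map (fun _ => fst _ _) ≫ A.op σ)
    (Limits.Pi.map (fun _ => snd _ _) ≫ B.op σ)
  sat e he := by
    apply CartesianMonoidalCategory.hom_ext
    · rw [interp_hom _ A.op (fst _ _) (fun _ => lift_fst _ _), A.sat e he,
        ← interp_hom _ A.op (fst _ _) (fun _ => lift_fst _ _)]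
    · rw [interp_hom _ B.op (snd _ _) (fun _ => lift_snd _ _), B.sat e he,
        ← interp_hom _ B.op (snd _ _) (fun _ => lift_snd _ _)]

lemma lift_prod_op {X Y : Alg E V} {n : ℕ} (σ : V.lang.Functions n) {T : E}
    (a : Fin n → (T ⟶ X.carrier ⊗ Y.carrier)) :
    Pi.lift a ≫ (prod X Y).op σ = lift (Pi.lift (fun i => a i ≫ fst _ _) ≫ X.op σ)
      (Pi.lift (fun i => a i ≫ snd _ _) ≫ Y.op σ) := by
  refine (comp_lift _ _ _).trans ?_
  simp only [← Category.assoc]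
  congr 2 <;> ext <;> simp

lemma isHom_toUnit (A : Alg E V) : IsHom A unit (toUnit _) := fun _ _ => toUnit_unique _ _

lemma isHom_fst (A B : Alg E V) : IsHom (prod A B) A (fst A.carrier B.carrier) :=
  fun _ _ => lift_fst _ _

lemma isHom_snd (A B : Alg E V) : IsHom (prod A B) B (snd A.carrier B.carrier) :=
  fun _ _ => lift_snd _ _

lemma isHom_lift {A B C : Alg E V} {f : A.carrier ⟶ B.carrier} {g : A.carrier ⟶ C.carrier}
    (hf : IsHom A B f) (hg : IsHom A C g) : IsHom A (prod B C) (lift f g) := fun n σ => by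
  have h₁ : Limits.Pi.map (fun _ : Fin n => lift f g) ≫ Limits.Pi.map (fun _ => fst _ _) =
      Limits.Pi.map (fun _ => f) := by ext; simp
  have h₂ : Limits.Pi.map (fun _ : Fin n => lift f g) ≫ Limits.Pi.map (fun _ => snd _ _) =
      Limits.Pi.map (fun _ => g) := by ext; simp
  apply CartesianMonoidalCategory.hom_ext
  · simp only [prod, Category.assoc, lift_fst]
    rw [hf, ← Category.assoc, h₁]
  · simp only [prod, Category.assoc, lift_snd]
    rw [hg, ← Category.assoc, h₂]

lemma isHom_tensor {A B C D : Alg E V} {f : A.carrier ⟶ B.carrier} {g : C.carrier ⟶ D.carrier}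
    (hf : IsHom A B f) (hg : IsHom C D g) : IsHom (prod A C) (prod B D) (f ⊗ₘ g) := by
  rw [← lift_fst_comp_snd_comp]
  exact isHom_lift ((isHom_fst _ _).comp hf) ((isHom_snd _ _).comp hg)

instance : MonoidalCategoryStruct (Alg E V) where
  tensorObj := prod
  tensorUnit := unit
  tensorHom f g := ⟨f.hom ⊗ₘ g.hom, isHom_tensor f.isHom g.isHom⟩
  whiskerLeft A _ _ g := ⟨A.carrier ◁ g.hom, by
    rw [← id_tensorHom]; exact isHom_tensor (.id A) g.isHom⟩
  whiskerRight f B := ⟨f.hom ▷ B.carrier, by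
    rw [← tensorHom_id]; exact isHom_tensor f.isHom (.id B)⟩
  associator A B C := mkIso (α_ A.carrier B.carrier C.carrier)
    (by
      have h : (α_ A.carrier B.carrier C.carrier).hom =
        lift (fst _ _ ≫ fst _ _) (lift (fst _ _ ≫ snd _ _) (snd _ _)) := by ext <;> simp
      rw [h]
      exact isHom_lift ((isHom_fst (prod A B) C).comp (isHom_fst A B))
        (isHom_lift ((isHom_fst (prod A B) C).comp (isHom_snd A B)) (isHom_snd (prod A B) C)))
    (by
      have h : (α_ A.carrier B.carrier C.carrier).inv =
        lift (lift (fst _ _) (snd _ _ ≫ fst _ _)) (snd _ _ ≫ snd _ _) := by ext <;> simp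
      rw [h]
      exact isHom_lift (isHom_lift (isHom_fst A (prod B C))
        ((isHom_snd A (prod B C)).comp (isHom_fst B C)))
        ((isHom_snd A (prod B C)).comp (isHom_snd B C)))
  leftUnitor A := mkIso (λ_ A.carrier)
    (by rw [leftUnitor_hom]; exact isHom_snd unit A)
    (by
      have h : (λ_ A.carrier).inv = lift (toUnit _) (𝟙 _) := by ext; simp
      rw [h]
      exact isHom_lift (isHom_toUnit A) (.id A))
  rightUnitor A := mkIso (ρ_ A.carrier)
    (by rw [rightUnitor_hom]; exact isHom_fst A unit)
    (by
      have h : (ρ_ A.carrier).inv = lift (𝟙 _) (toUnit _) := by ext; simp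
      rw [h]
      exact isHom_lift (.id A) (isHom_toUnit A))

@[simp] lemma tensorObj_carrier (A B : Alg E V) : (A ⊗ B).carrier = A.carrier ⊗ B.carrier := rfl
@[simp] lemma tensorUnit_carrier : (𝟙_ (Alg E V)).carrier = 𝟙_ E := rfl
@[simp] lemma tensorHom_hom {A B C D : Alg E V} (f : A ⟶ B) (g : C ⟶ D) :
    (f ⊗ₘ g).hom = f.hom ⊗ₘ g.hom := rfl
@[simp] lemma whiskerLeft_hom (A : Alg E V) {C D : Alg E V} (g : C ⟶ D) :
    (A ◁ g).hom = A.carrier ◁ g.hom := rfl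
@[simp] lemma whiskerRight_hom {A B : Alg E V} (f : A ⟶ B) (C : Alg E V) :
    (f ▷ C).hom = f.hom ▷ C.carrier := rfl
@[simp] lemma associator_hom_hom (A B C : Alg E V) :
    (α_ A B C).hom.hom = (α_ A.carrier B.carrier C.carrier).hom := rfl
@[simp] lemma associator_inv_hom (A B C : Alg E V) :
    (α_ A B C).inv.hom = (α_ A.carrier B.carrier C.carrier).inv := rfl
@[simp] lemma leftUnitor_hom_hom (A : Alg E V) : (λ_ A).hom.hom = (λ_ A.carrier).hom := rfl
@[simp] lemma leftUnitor_inv_hom (A : Alg E V) : (λ_ A).inv.hom = (λ_ A.carrier).inv := rfl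
@[simp] lemma rightUnitor_hom_hom (A : Alg E V) : (ρ_ A).hom.hom = (ρ_ A.carrier).hom := rfl
@[simp] lemma rightUnitor_inv_hom (A : Alg E V) : (ρ_ A).inv.hom = (ρ_ A.carrier).inv := rfl

/-- The category of algebras has finite products, computed as in `E`. -/
instance : CartesianMonoidalCategory (Alg E V) where
  tensorHom_def _ _ := by ext1; simp [MonoidalCategory.tensorHom_def]
  id_tensorHom_id _ _ := by ext1; simp
  tensorHom_comp_tensorHom _ _ _ _ := by ext1; simp
  whiskerLeft_id _ _ := by ext1; simp
  id_whiskerRight _ _ := by ext1; simp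
  associator_naturality _ _ _ := by ext1; simp
  leftUnitor_naturality _ := by ext1; simp
  rightUnitor_naturality _ := by ext1; simp
  pentagon _ _ _ _ := by ext1; simp
  triangle _ _ := by ext1; simp
  isTerminalTensorUnit := IsTerminal.ofUniqueHom
    (fun A => ⟨toUnit _, isHom_toUnit A⟩) (fun A f => by ext1; exact toUnit_unique _ _)
  fst A B := ⟨fst _ _, isHom_fst A B⟩
  snd A B := ⟨snd _ _, isHom_snd A B⟩
  tensorProductIsBinaryProduct A B := BinaryFan.IsLimit.mk _
    (fun f g => ⟨lift f.hom g.hom, isHom_lift f.isHom g.isHom⟩)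
    (fun f g => by ext1; simp)
    (fun f g => by ext1; simp)
    (fun f g m hf hg => by
      ext1
      apply CartesianMonoidalCategory.hom_ext
      · simpa using congrArg Hom.hom hf
      · simpa using congrArg Hom.hom hg)
  fst_def A B := by
    ext1
    simp only [fst_def, comp_hom, whiskerLeft_hom, rightUnitor_hom_hom]
    congr 2
  snd_def A B := by
    ext1
    simp only [snd_def, comp_hom, whiskerRight_hom, leftUnitor_hom_hom]
    congr 2

instance : BraidedCategory (Alg E V) := .ofCartesianMonoidalCategory

@[simp] lemma fst_hom (A B : Alg E V) : (fst A B).hom = fst A.carrier B.carrier := rfl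
@[simp] lemma snd_hom (A B : Alg E V) : (snd A B).hom = snd A.carrier B.carrier := rfl
@[simp] lemma lift_hom {A B C : Alg E V} (f : A ⟶ B) (g : A ⟶ C) :
    (lift f g).hom = lift f.hom g.hom := rfl
@[simp] lemma toUnit_hom (A : Alg E V) : (toUnit A).hom = toUnit A.carrier := rfl

end Alg

/-! ### Internal partially ordered commutative monoids -/

/-- An internal partially ordered commutative monoid of `E`. The order is a subobject of `Q × Q`;
its axioms are stated for generalized elements `T ⟶ Q`, where `a ≤ b` means that
`⟨a, b⟩ : T ⟶ Q × Q` factors through that subobject, and where `a * b` is `⟨a, b⟩` followed by the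
multiplication of `Q`. -/
structure PoCommMon (E : Type u) [Category.{v} E] [CartesianMonoidalCategory E]
    [BraidedCategory E] where
  carrier : E
  [mon : MonObj carrier]
  [comm : IsCommMonObj carrier]
  le : Subobject (carrier ⊗ carrier)
  le_refl : ∀ {T : E} (a : T ⟶ carrier), le.Factors (lift a a)
  le_trans : ∀ {T : E} (a b c : T ⟶ carrier),
    le.Factors (lift a b) → le.Factors (lift b c) → le.Factors (lift a c)
  le_antisymm : ∀ {T : E} (a b : T ⟶ carrier),
    le.Factors (lift a b) → le.Factors (lift b a) → a = b
  mul_le_mul : ∀ {T : E} (a b c d : T ⟶ carrier),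
    le.Factors (lift a b) → le.Factors (lift c d) → le.Factors (lift (a * c) (b * d))

attribute [instance] PoCommMon.mon PoCommMon.comm

/-! ### `Q`-spans -/

section Spans

variable {E : Type u} [Category.{v} E]

/-- A `Q`-span from `A` to `B`: a span together with a characteristic morphism to `Q`. -/
structure QSpan (Q A B : E) where
  apex : E
  left : apex ⟶ A
  right : apex ⟶ B
  chi : apex ⟶ Q

namespace QSpan

variable {Q : E} {A B C D : E}

/-- Isomorphism of `Q`-spans. -/
def Equiv (S T : QSpan Q A B) : Prop :=
  ∃ i : S.apex ≅ T.apex,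
    S.left = i.hom ≫ T.left ∧ S.right = i.hom ≫ T.right ∧ S.chi = i.hom ≫ T.chi

lemma Equiv.refl (S : QSpan Q A B) : S.Equiv S := ⟨Iso.refl _, by simp, by simp, by simp⟩

lemma Equiv.symm {S T : QSpan Q A B} : S.Equiv T → T.Equiv S := by
  rintro ⟨i, h₁, h₂, h₃⟩
  exact ⟨i.symm, by simp [h₁], by simp [h₂], by simp [h₃]⟩

lemma Equiv.trans {S T U : QSpan Q A B} : S.Equiv T → T.Equiv U → S.Equiv U := by
  rintro ⟨i, h₁, h₂, h₃⟩ ⟨j, k₁, k₂, k₃⟩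
  exact ⟨i ≪≫ j, by simp [h₁, k₁], by simp [h₂, k₂], by simp [h₃, k₃]⟩

/-- The converse of a `Q`-span. -/
@[simps]
def converse (S : QSpan Q A B) : QSpan Q B A := ⟨S.apex, S.right, S.left, S.chi⟩

lemma Equiv.converse {S T : QSpan Q A B} : S.Equiv T → S.converse.Equiv T.converse := by
  rintro ⟨i, h₁, h₂, h₃⟩
  exact ⟨i, h₂, h₁, h₃⟩

lemma equiv_mk {X Y : E} {f : X ⟶ A} {g : X ⟶ B} {c : X ⟶ Q} {f' : Y ⟶ A} {g' : Y ⟶ B} {c' : Y ⟶ Q}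
    (i : X ≅ Y) (h₁ : f = i.hom ≫ f') (h₂ : g = i.hom ≫ g') (h₃ : c = i.hom ≫ c') :
    Equiv (⟨X, f, g, c⟩ : QSpan Q A B) ⟨Y, f', g', c'⟩ := ⟨i, h₁, h₂, h₃⟩

lemma equiv_mk_eq {X : E} {f f' : X ⟶ A} {g g' : X ⟶ B} {c c' : X ⟶ Q}
    (h₁ : f = f') (h₂ : g = g') (h₃ : c = c') :
    Equiv (⟨X, f, g, c⟩ : QSpan Q A B) ⟨X, f', g', c'⟩ :=
  equiv_mk (Iso.refl X) (by simp [h₁]) (by simp [h₂]) (by simp [h₃])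

variable [CartesianMonoidalCategory E] [MonObj Q]

/-- The graph of a morphism; here `1` is the constant morphism at the unit of `Q`. -/
@[simps]
def graph (f : A ⟶ B) : QSpan Q A B := ⟨A, 𝟙 A, f, 1⟩

/-- The tensor product of `Q`-spans: the product of the underlying spans, with characteristic
morphism `(x, y) ↦ χ(x) * ξ(y)`. -/
@[simps]
def tensor (S : QSpan Q A B) (T : QSpan Q C D) : QSpan Q (A ⊗ C) (B ⊗ D) :=
  ⟨S.apex ⊗ T.apex, S.left ⊗ₘ T.left, S.right ⊗ₘ T.right, (fst _ _ ≫ S.chi) * (snd _ _ ≫ T.chi)⟩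

/-- Composition of `Q`-spans by pullback, with characteristic morphism `(x, y) ↦ χ(x) * ξ(y)`. -/
def comp [HasPullbacks E] (S : QSpan Q A B) (T : QSpan Q B C) : QSpan Q A C where
  apex := pullback S.right T.left
  left := pullback.fst S.right T.left ≫ S.left
  right := pullback.snd S.right T.left ≫ T.right
  chi := (pullback.fst S.right T.left ≫ S.chi) * (pullback.snd S.right T.left ≫ T.chi)

lemma tensor_mk {X Y : E} (f : X ⟶ A) (g : X ⟶ B) (c : X ⟶ Q) (f' : Y ⟶ C) (g' : Y ⟶ D)
    (c' : Y ⟶ Q) : tensor ⟨X, f, g, c⟩ ⟨Y, f', g', c'⟩ =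
      ⟨X ⊗ Y, f ⊗ₘ f', g ⊗ₘ g', (fst X Y ≫ c) * (snd X Y ≫ c')⟩ := rfl

lemma Equiv.tensor {S S' : QSpan Q A B} {T T' : QSpan Q C D} (hS : S.Equiv S') (hT : T.Equiv T') :
    (S.tensor T).Equiv (S'.tensor T') := by
  obtain ⟨i, h₁, h₂, h₃⟩ := hS
  obtain ⟨j, k₁, k₂, k₃⟩ := hT
  refine equiv_mk (i ⊗ᵢ j) ?_ ?_ ?_
  · simp [h₁, k₁]
  · simp [h₂, k₂]
  · simp [h₃, k₃, MonObj.comp_mul]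

lemma isPullback_tensor {X Y Z P X' Y' Z' P' : E} {p : P ⟶ X} {q : P ⟶ Y} {f : X ⟶ Z} {g : Y ⟶ Z}
    {p' : P' ⟶ X'} {q' : P' ⟶ Y'} {f' : X' ⟶ Z'} {g' : Y' ⟶ Z'} (h : IsPullback p q f g)
    (h' : IsPullback p' q' f' g') :
    IsPullback (p ⊗ₘ p') (q ⊗ₘ q') (f ⊗ₘ f') (g ⊗ₘ g') := by
  refine ⟨⟨by simp [h.w, h'.w]⟩, ⟨PullbackCone.IsLimit.mk _
    (fun s => lift (h.lift (s.fst ≫ fst _ _) (s.snd ≫ fst _ _) ?_)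
      (h'.lift (s.fst ≫ snd _ _) (s.snd ≫ snd _ _) ?_)) ?_ ?_ ?_⟩⟩
  · simpa using s.condition =≫ fst _ _
  · simpa using s.condition =≫ snd _ _
  · intro s
    ext <;> simp
  · intro s
    ext <;> simp
  · intro s m h₁ h₂
    apply CartesianMonoidalCategory.hom_ext
    · apply h.hom_ext
      · simp [← h₁]
      · simp [← h₂]
    · apply h'.hom_ext
      · simp [← h₁]
      · simp [← h₂]

lemma tensor_graph {A' B' : E} (f : A ⟶ B) (g : A' ⟶ B') :
    ((graph (Q := Q) f).tensor (graph g)).Equiv (graph (f ⊗ₘ g)) := by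
  refine equiv_mk_eq (id_tensorHom_id A A') rfl ?_
  change (fst A A' ≫ (1 : A ⟶ Q)) * (snd A A' ≫ (1 : A' ⟶ Q)) = 1
  simp [MonObj.comp_one]

variable [HasPullbacks E]

/-- Composites may be computed with an arbitrary pullback. -/
lemma comp_equiv {X Y P : E} {f : X ⟶ A} {g : X ⟶ B} {c : X ⟶ Q} {f' : Y ⟶ B} {g' : Y ⟶ C}
    {c' : Y ⟶ Q} {p : P ⟶ X} {q : P ⟶ Y} (h : IsPullback p q g f') :
    Equiv (comp (⟨X, f, g, c⟩ : QSpan Q A B) ⟨Y, f', g', c'⟩)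
      ⟨P, p ≫ f, q ≫ g', (p ≫ c) * (q ≫ c')⟩ :=
  equiv_mk ((IsPullback.of_hasPullback g f').isoIsPullback _ _ h) (by simp) (by simp)
    (by simp [MonObj.comp_mul])

lemma Equiv.comp {S S' : QSpan Q A B} {T T' : QSpan Q B C} (hS : S.Equiv S') (hT : T.Equiv T') :
    (S.comp T).Equiv (S'.comp T') := by
  obtain ⟨X, f, g, c⟩ := S
  obtain ⟨X', f', g', c'⟩ := S'
  obtain ⟨Y, h, k, d⟩ := T
  obtain ⟨Y', h', k', d'⟩ := T'
  obtain ⟨i, h₁, h₂, h₃⟩ := hS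
  obtain ⟨j, k₁, k₂, k₃⟩ := hT
  dsimp only at *
  have hp : IsPullback (pullback.fst g h ≫ i.hom) (pullback.snd g h ≫ j.hom) g' h' :=
    (IsPullback.of_hasPullback g h).of_iso (Iso.refl _) i j (Iso.refl _)
      (by simp) (by simp) (by simp [h₂]) (by simp [k₁])
  refine (comp_equiv (.of_hasPullback g h)).trans
    (Equiv.trans (equiv_mk_eq ?_ ?_ ?_) (comp_equiv hp).symm)
  · simp [h₁]
  · simp [k₂]
  · simp [h₃, k₃]

lemma comp_graph {X : E} (f : X ⟶ A) (g : X ⟶ B) (c : X ⟶ Q) (k : B ⟶ C) :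
    (comp ⟨X, f, g, c⟩ (graph k)).Equiv ⟨X, f, g ≫ k, c⟩ := by
  refine (comp_equiv (IsPullback.id_horiz g)).trans (equiv_mk_eq ?_ ?_ ?_) <;>
    simp [MonObj.comp_one]

lemma graph_comp_of_iso (h : A ≅ B) {X : E} (f : X ⟶ B) (g : X ⟶ C) (c : X ⟶ Q) :
    ((graph h.hom).comp ⟨X, f, g, c⟩).Equiv ⟨X, f ≫ h.inv, g, c⟩ := by
  have hp : IsPullback (f ≫ h.inv) (𝟙 X) h.hom f := .of_vert_isIso ⟨by simp⟩
  refine (comp_equiv hp).trans (equiv_mk_eq ?_ ?_ ?_) <;> simp [MonObj.comp_one]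

lemma id_comp (S : QSpan Q A B) : ((graph (𝟙 A)).comp S).Equiv S := by
  obtain ⟨X, f, g, c⟩ := S
  refine (graph_comp_of_iso (Iso.refl A) f g c).trans (equiv_mk_eq ?_ ?_ ?_) <;> simp

lemma comp_id (S : QSpan Q A B) : (S.comp (graph (𝟙 B))).Equiv S := by
  obtain ⟨X, f, g, c⟩ := S
  refine (comp_graph f g c (𝟙 B)).trans (equiv_mk_eq ?_ ?_ ?_) <;> simp

lemma graph_comp_graph (f : A ⟶ B) (g : B ⟶ C) :
    ((graph (Q := Q) f).comp (graph g)).Equiv (graph (f ≫ g)) :=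
  comp_graph (𝟙 A) f 1 g

lemma assoc (S : QSpan Q A B) (T : QSpan Q B C) (U : QSpan Q C D) :
    ((S.comp T).comp U).Equiv (S.comp (T.comp U)) := by
  obtain ⟨X, f, g, c⟩ := S
  obtain ⟨Y, f', g', c'⟩ := T
  obtain ⟨Z, f'', g'', c''⟩ := U
  have h₁ := IsPullback.of_hasPullback g f'
  have h₂ := IsPullback.of_hasPullback g' f''
  have h₃ := IsPullback.of_hasPullback (pullback.snd g f') (pullback.fst g' f'')
  refine ((comp_equiv h₁).comp (.refl _)).trans ((comp_equiv (h₃.paste_vert h₂)).trans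
    (Equiv.trans (equiv_mk_eq ?_ ?_ ?_) (Equiv.symm (((Equiv.refl _).comp
      (comp_equiv h₂)).trans (comp_equiv (h₃.flip.paste_vert h₁.flip).flip)))))
  · simp
  · simp
  · simp [MonObj.comp_mul, mul_assoc, pullback.condition_assoc]

section

variable [BraidedCategory E] [IsCommMonObj Q] {A' B' C' A'' B'' : E}

lemma tensor_comp (S : QSpan Q A B) (T : QSpan Q B C) (S' : QSpan Q A' B') (T' : QSpan Q B' C') :
    ((S.tensor S').comp (T.tensor T')).Equiv ((S.comp T).tensor (S'.comp T')) := by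
  obtain ⟨X, f, g, c⟩ := S
  obtain ⟨Y, h, k, d⟩ := T
  obtain ⟨X', f', g', c'⟩ := S'
  obtain ⟨Y', h', k', d'⟩ := T'
  have h₁ := IsPullback.of_hasPullback g h
  have h₂ := IsPullback.of_hasPullback g' h'
  refine (comp_equiv (isPullback_tensor h₁ h₂)).trans (Equiv.trans (equiv_mk_eq ?_ ?_ ?_)
    ((comp_equiv h₁).tensor (comp_equiv h₂)).symm)
  · simp
  · simp
  · simp [MonObj.comp_mul, mul_mul_mul_comm]

lemma braiding_naturality (S : QSpan Q A B) (S' : QSpan Q A' B') :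
    ((S.tensor S').comp (graph (β_ B B').hom)).Equiv
      ((graph (β_ A A').hom).comp (S'.tensor S)) := by
  obtain ⟨X, f, g, c⟩ := S
  obtain ⟨X', f', g', c'⟩ := S'
  refine (comp_graph _ _ _ _).trans (Equiv.trans (equiv_mk (β_ X X') ?_ ?_ ?_)
    (graph_comp_of_iso (β_ A A') _ _ _).symm)
  · simp
  · simp
  · simp [MonObj.comp_mul, mul_comm]

end

lemma associator_naturality {A' B' A'' B'' : E} (S : QSpan Q A B) (S' : QSpan Q A' B')
    (S'' : QSpan Q A'' B'') :
    (((S.tensor S').tensor S'').comp (graph (α_ B B' B'').hom)).Equiv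
      ((graph (α_ A A' A'').hom).comp (S.tensor (S'.tensor S''))) := by
  obtain ⟨X, f, g, c⟩ := S
  obtain ⟨X', f', g', c'⟩ := S'
  obtain ⟨X'', f'', g'', c''⟩ := S''
  simp only [tensor_mk]
  refine (comp_graph _ _ _ _).trans (Equiv.trans (equiv_mk (α_ X X' X'') ?_ ?_ ?_)
    (graph_comp_of_iso (α_ A A' A'') _ _ _).symm)
  · simp
  · simp
  · simp [MonObj.comp_mul, mul_assoc]

lemma leftUnitor_naturality (S : QSpan Q A B) :
    (((graph (𝟙 (𝟙_ E))).tensor S).comp (graph (λ_ B).hom)).Equiv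
      ((graph (λ_ A).hom).comp S) := by
  obtain ⟨X, f, g, c⟩ := S
  change (comp (tensor ⟨𝟙_ E, 𝟙 _, 𝟙 _, 1⟩ ⟨X, f, g, c⟩) _).Equiv _
  rw [tensor_mk]
  refine (comp_graph _ _ _ _).trans (Equiv.trans (equiv_mk (λ_ X) ?_ ?_ ?_)
    (graph_comp_of_iso (λ_ A) _ _ _).symm)
  · simp
  · simp
  · simp [MonObj.comp_one, leftUnitor_hom]

lemma rightUnitor_naturality (S : QSpan Q A B) :
    ((S.tensor (graph (𝟙 (𝟙_ E)))).comp (graph (ρ_ B).hom)).Equiv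
      ((graph (ρ_ A).hom).comp S) := by
  obtain ⟨X, f, g, c⟩ := S
  change (comp (tensor ⟨X, f, g, c⟩ ⟨𝟙_ E, 𝟙 _, 𝟙 _, 1⟩) _).Equiv _
  rw [tensor_mk]
  refine (comp_graph _ _ _ _).trans (Equiv.trans (equiv_mk (ρ_ X) ?_ ?_ ?_)
    (graph_comp_of_iso (ρ_ A) _ _ _).symm)
  · simp
  · simp
  · simp [MonObj.comp_one, rightUnitor_hom]

end QSpan

end Spans

/-! ### Algebraic `Q`-spans -/

section AlgebraicSpans

variable {E : Type u} [Category.{v} E] [CartesianMonoidalCategory E] [BraidedCategory E]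
  {V : Variety.{w}} {Q : PoCommMon E} {A B C D : Alg E V}

/-- Algebraic `Q`-spans. This is the Kripke-Joyal interpretation in the topos `E` of the formula:
for every operation `σ` and all `x₁, …, xₙ` in the apex there exists `y` in the apex with
`f y = σ (f x₁, …, f xₙ)`, `g y = σ (g x₁, …, g xₙ)` and `χ x₁ * ⋯ * χ xₙ ≤ χ y`.
That is, universally quantified variables range over generalized elements at an arbitrary stage `T`,
and existence at stage `T` is witnessed after passing to a cover of `T`, i.e. along an
epimorphism `e : T' ⟶ T`. -/
def IsAlgebraic (S : QSpan Q.carrier A.carrier B.carrier) : Prop :=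
  ∀ ⦃n : ℕ⦄ (σ : V.lang.Functions n) ⦃T : E⦄ (x : Fin n → (T ⟶ S.apex)),
    ∃ (T' : E) (e : T' ⟶ T) (y : T' ⟶ S.apex), Epi e ∧
      y ≫ S.left = e ≫ Pi.lift (fun i => x i ≫ S.left) ≫ A.op σ ∧
      y ≫ S.right = e ≫ Pi.lift (fun i => x i ≫ S.right) ≫ B.op σ ∧
      Q.le.Factors (lift (e ≫ ∏ i, (x i ≫ S.chi)) (y ≫ S.chi))

namespace IsAlgebraic

lemma comp_prod {T T' : E} (e : T' ⟶ T) {n : ℕ} (a : Fin n → (T ⟶ Q.carrier)) :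
    e ≫ ∏ i, a i = ∏ i, (e ≫ a i) :=
  map_prod (⟨⟨fun a => e ≫ a, MonObj.comp_one e⟩, fun a b => MonObj.comp_mul e a b⟩ :
    (T ⟶ Q.carrier) →* (T' ⟶ Q.carrier)) a Finset.univ

lemma le_comp {T T' : E} (e : T' ⟶ T) {a b : T ⟶ Q.carrier} (h : Q.le.Factors (lift a b)) :
    Q.le.Factors (lift (e ≫ a) (e ≫ b)) := by
  rw [← comp_lift]
  exact Subobject.factors_of_factors_right e h

lemma of_equiv {S T : QSpan Q.carrier A.carrier B.carrier} (h : S.Equiv T)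
    (hS : IsAlgebraic (A := A) (B := B) S) : IsAlgebraic (A := A) (B := B) T := by
  obtain ⟨i, h₁, h₂, h₃⟩ := h.symm
  obtain ⟨X, f, g, c⟩ := S
  obtain ⟨X', f', g', c'⟩ := T
  intro n σ U x
  dsimp only at i h₁ h₂ h₃ x
  obtain ⟨U', e, y, he, k₁, k₂, k₃⟩ := hS σ (fun j => x j ≫ i.hom)
  dsimp only at y k₁ k₂ k₃ ⊢
  subst h₁ h₂ h₃
  exact ⟨U', e, y ≫ i.inv, he, by simpa using k₁, by simpa using k₂, by simpa using k₃⟩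

lemma converse {S : QSpan Q.carrier A.carrier B.carrier}
    (hS : IsAlgebraic (A := A) (B := B) S) : IsAlgebraic (A := B) (B := A) S.converse := by
  intro n σ U x
  obtain ⟨U', e, y, he, k₁, k₂, k₃⟩ := hS σ x
  exact ⟨U', e, y, he, k₂, k₁, k₃⟩

lemma graph (f : A ⟶ B) :
    IsAlgebraic (A := A) (B := B) (QSpan.graph (Q := Q.carrier) f.hom) := by
  intro n σ U x
  change Fin n → (U ⟶ A.carrier) at x
  refine ⟨U, 𝟙 U, Pi.lift x ≫ A.op σ, inferInstance, ?_, ?_, ?_⟩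
  · change (Pi.lift x ≫ A.op σ) ≫ 𝟙 _ = 𝟙 U ≫ Pi.lift (fun i => x i ≫ 𝟙 _) ≫ A.op σ
    simp
  · change (Pi.lift x ≫ A.op σ) ≫ f.hom = 𝟙 U ≫ Pi.lift (fun i => x i ≫ f.hom) ≫ B.op σ
    rw [Category.assoc, f.isHom σ, Category.id_comp, ← Category.assoc]
    congr 1
    ext
    simp
  · change Q.le.Factors (lift (𝟙 U ≫ ∏ i, (x i ≫ (1 : A.carrier ⟶ Q.carrier)))
      ((Pi.lift x ≫ A.op σ) ≫ (1 : A.carrier ⟶ Q.carrier)))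
    simp only [MonObj.comp_one, Finset.prod_const_one]
    exact Q.le_refl _

lemma comp [HasPullbacks E] {S : QSpan Q.carrier A.carrier B.carrier}
    {T : QSpan Q.carrier B.carrier C.carrier} (hS : IsAlgebraic (A := A) (B := B) S)
    (hT : IsAlgebraic (A := B) (B := C) T) : IsAlgebraic (A := A) (B := C) (S.comp T) := by
  intro n σ U x
  change Fin n → (U ⟶ pullback S.right T.left) at x
  obtain ⟨U', e, y, he, k₁, k₂, k₃⟩ := hS σ (fun i => x i ≫ pullback.fst S.right T.left)
  obtain ⟨U'', e', y', he', l₁, l₂, l₃⟩ :=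
    hT σ (fun i => e ≫ x i ≫ pullback.snd S.right T.left)
  have hw : (e' ≫ y) ≫ S.right = y' ≫ T.left := by
    rw [Category.assoc, k₂, l₁]
    congr 1
    rw [← Category.assoc, comp_piLift]
    simp [pullback.condition]
  refine ⟨U'', e' ≫ e, pullback.lift (e' ≫ y) y' hw, epi_comp _ _, ?_, ?_, ?_⟩
  · change pullback.lift (e' ≫ y) y' hw ≫ pullback.fst _ _ ≫ S.left =
      (e' ≫ e) ≫ Pi.lift (fun i => x i ≫ pullback.fst _ _ ≫ S.left) ≫ A.op σ
    rw [pullback.lift_fst_assoc, Category.assoc, k₁]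
    simp only [Category.assoc]
  · change pullback.lift (e' ≫ y) y' hw ≫ pullback.snd _ _ ≫ T.right =
      (e' ≫ e) ≫ Pi.lift (fun i => x i ≫ pullback.snd _ _ ≫ T.right) ≫ C.op σ
    simp only [pullback.lift_snd_assoc, l₂, Category.assoc]
    congr 1
    rw [← Category.assoc e, comp_piLift]
  · change Q.le.Factors (lift ((e' ≫ e) ≫ ∏ i, (x i ≫ (pullback.fst _ _ ≫ S.chi *
      pullback.snd _ _ ≫ T.chi))) (pullback.lift (e' ≫ y) y' hw ≫ (pullback.fst _ _ ≫ S.chi *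
      pullback.snd _ _ ≫ T.chi)))
    have h := Q.mul_le_mul _ _ _ _ (le_comp e' k₃) l₃
    simp only [MonObj.comp_mul, pullback.lift_fst_assoc, pullback.lift_snd_assoc,
      Finset.prod_mul_distrib]
    simpa only [comp_prod, Category.assoc] using h

lemma tensor {S : QSpan Q.carrier A.carrier B.carrier} {T : QSpan Q.carrier C.carrier D.carrier}
    (hS : IsAlgebraic (A := A) (B := B) S) (hT : IsAlgebraic (A := C) (B := D) T) :
    IsAlgebraic (A := A ⊗ C) (B := B ⊗ D) (S.tensor T) := by
  intro n σ U x
  change Fin n → (U ⟶ S.apex ⊗ T.apex) at x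
  obtain ⟨U', e, y, he, k₁, k₂, k₃⟩ := hS σ (fun i => x i ≫ fst _ _)
  obtain ⟨U'', e', y', he', l₁, l₂, l₃⟩ := hT σ (fun i => e ≫ x i ≫ snd _ _)
  have key : ∀ {X Y : Alg E V} (f : S.apex ⟶ X.carrier) (g : T.apex ⟶ Y.carrier),
      y ≫ f = e ≫ Pi.lift (fun i => (x i ≫ fst _ _) ≫ f) ≫ X.op σ →
      y' ≫ g = e' ≫ Pi.lift (fun i => (e ≫ x i ≫ snd _ _) ≫ g) ≫ Y.op σ →
      lift (e' ≫ y) y' ≫ (f ⊗ₘ g) =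
        (e' ≫ e) ≫ Pi.lift (fun i => x i ≫ (f ⊗ₘ g)) ≫ (X ⊗ Y).op σ := by
    intro X Y f g hf hg
    have h := Alg.lift_prod_op (X := X) (Y := Y) σ (fun i => x i ≫ (f ⊗ₘ g))
    refine Eq.trans ?_ ((congrArg (fun t => (e' ≫ e) ≫ t) h).trans (comp_lift _ _ _)).symm
    simp only [Category.assoc, lift_map, tensorHom_fst, tensorHom_snd, hf, hg]
    congr 2
    rw [← Category.assoc e, comp_piLift]
  refine ⟨U'', e' ≫ e, lift (e' ≫ y) y', epi_comp _ _, key _ _ k₁ l₁, key _ _ k₂ l₂, ?_⟩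
  change Q.le.Factors (lift ((e' ≫ e) ≫ ∏ i, (x i ≫ (fst _ _ ≫ S.chi * snd _ _ ≫ T.chi)))
    (lift (e' ≫ y) y' ≫ (fst _ _ ≫ S.chi * snd _ _ ≫ T.chi)))
  have h := Q.mul_le_mul _ _ _ _ (le_comp e' k₃) l₃
  simp only [MonObj.comp_mul, lift_fst_assoc, lift_snd_assoc, Finset.prod_mul_distrib]
  simpa only [comp_prod, Category.assoc] using h

end IsAlgebraic

variable (Q A B) in
/-- Algebraic `Q`-spans between the algebras `A` and `B`. -/
def AlgSpan : Type max u v :=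
  {S : QSpan Q.carrier A.carrier B.carrier // IsAlgebraic (A := A) (B := B) S}

variable (Q A B) in
/-- Isomorphism of algebraic `Q`-spans. -/
instance AlgSpan.setoid : Setoid (AlgSpan Q A B) where
  r S T := S.1.Equiv T.1
  iseqv := ⟨fun S => .refl S.1, .symm, .trans⟩

end AlgebraicSpans

/-! ### The category of algebras and algebraic `Q`-spans -/

section SpanCat

variable {E : Type u} [Category.{v} E] [CartesianMonoidalCategory E] [BraidedCategory E]

/-- The category with objects the `V`-algebras in `E`, and morphisms the isomorphism classes of
algebraic `Q`-spans. -/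
@[ext]
structure SpanCat (V : Variety.{w}) (Q : PoCommMon E) where
  alg : Alg E V

namespace SpanCat

variable {V : Variety.{w}} {Q : PoCommMon E}

/-- Isomorphism classes of algebraic `Q`-spans. -/
def Hom (A B : SpanCat V Q) : Type max u v := Quotient (AlgSpan.setoid Q A.alg B.alg)

/-- The isomorphism class of an algebraic `Q`-span. -/
def Hom.mk {A B : SpanCat V Q} (S : AlgSpan Q A.alg B.alg) : Hom A B := Quotient.mk _ S

/-- The graph of a homomorphism. -/
def graphHom {A B : Alg E V} (f : A ⟶ B) : Hom (⟨A⟩ : SpanCat V Q) ⟨B⟩ :=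
  Hom.mk ⟨QSpan.graph f.hom, .graph f⟩

/-- The converse of an isomorphism class of algebraic `Q`-spans. -/
def converseHom {A B : SpanCat V Q} : Hom A B → Hom B A :=
  Quotient.map (fun S => ⟨S.1.converse, S.2.converse⟩) (fun _ _ h => QSpan.Equiv.converse h)

/-- The tensor product of isomorphism classes of algebraic `Q`-spans. -/
def tensorHom' {A B C D : SpanCat V Q} :
    Hom A B → Hom C D → Hom (⟨A.alg ⊗ C.alg⟩ : SpanCat V Q) ⟨B.alg ⊗ D.alg⟩ :=
  Quotient.map₂ (fun S T => ⟨S.1.tensor T.1, S.2.tensor T.2⟩)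
    (fun _ _ h _ _ h' => QSpan.Equiv.tensor h h')

variable [HasPullbacks E]

/-- Composition of isomorphism classes of algebraic `Q`-spans. -/
def compHom {A B C : SpanCat V Q} : Hom A B → Hom B C → Hom A C :=
  Quotient.map₂ (fun S T => ⟨S.1.comp T.1, S.2.comp T.2⟩)
    (fun _ _ h _ _ h' => QSpan.Equiv.comp h h')

instance : Category.{max u v} (SpanCat V Q) where
  Hom := Hom
  id A := graphHom (𝟙 A.alg)
  comp := compHom
  id_comp := by
    rintro A B ⟨S⟩
    exact Quotient.sound (QSpan.id_comp S.1)
  comp_id := by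
    rintro A B ⟨S⟩
    exact Quotient.sound (QSpan.comp_id S.1)
  assoc := by
    rintro A B C D ⟨S⟩ ⟨T⟩ ⟨U⟩
    exact Quotient.sound (QSpan.assoc S.1 T.1 U.1)

variable (V Q) in
/-- The graph functor: it is the identity on objects and sends `f : A ⟶ B` to the class of
`(A, 1, f, χ_k)`. -/
def graph : Alg E V ⥤ SpanCat V Q where
  obj A := ⟨A⟩
  map f := graphHom f
  map_id _ := rfl
  map_comp f g := (Quotient.sound (QSpan.graph_comp_graph f.hom g.hom)).symm

/-- The converse of a morphism: it sends the class of `(X, f, g, χ)` to that of `(X, g, f, χ)`. -/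
def converse {A B : SpanCat V Q} (R : A ⟶ B) : B ⟶ A := converseHom R

instance : MonoidalCategoryStruct (SpanCat V Q) where
  tensorObj A B := ⟨A.alg ⊗ B.alg⟩
  tensorUnit := ⟨𝟙_ (Alg E V)⟩
  tensorHom f g := tensorHom' f g
  whiskerLeft A _ _ g := tensorHom' (𝟙 A) g
  whiskerRight f B := tensorHom' f (𝟙 B)
  associator A B C := (graph V Q).mapIso (α_ A.alg B.alg C.alg)
  leftUnitor A := (graph V Q).mapIso (λ_ A.alg)
  rightUnitor A := (graph V Q).mapIso (ρ_ A.alg)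

lemma graph_tensor {A B C D : Alg E V} (f : A ⟶ B) (g : C ⟶ D) :
    (graph V Q).map f ⊗ₘ (graph V Q).map g = (graph V Q).map (f ⊗ₘ g) :=
  Quotient.sound (QSpan.tensor_graph f.hom g.hom)

/-- The monoidal structure is inherited from the finite products of algebras. -/
instance : MonoidalCategory (SpanCat V Q) := .ofTensorHom
  (id_tensorHom_id := fun A B => (graph_tensor (𝟙 A.alg) (𝟙 B.alg)).trans
    (congrArg (graph V Q).map (id_tensorHom_id A.alg B.alg)))
  (id_tensorHom := fun _ _ _ _ => rfl)
  (tensorHom_id := fun _ _ => rfl)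
  (tensorHom_comp_tensorHom := by
    rintro _ _ _ _ _ _ ⟨S⟩ ⟨S'⟩ ⟨T⟩ ⟨T'⟩
    exact Quotient.sound (QSpan.tensor_comp S.1 T.1 S'.1 T'.1))
  (associator_naturality := by
    rintro _ _ _ _ _ _ ⟨S⟩ ⟨S'⟩ ⟨S''⟩
    exact Quotient.sound (QSpan.associator_naturality S.1 S'.1 S''.1))
  (leftUnitor_naturality := by
    rintro _ _ ⟨S⟩
    exact Quotient.sound (QSpan.leftUnitor_naturality S.1))
  (rightUnitor_naturality := by
    rintro _ _ ⟨S⟩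
    exact Quotient.sound (QSpan.rightUnitor_naturality S.1))
  (pentagon := fun A B C D => by
    have h := congrArg (graph V Q).map (MonoidalCategory.pentagon A.alg B.alg C.alg D.alg)
    simp only [← MonoidalCategory.tensorHom_id, ← MonoidalCategory.id_tensorHom,
      Functor.map_comp, ← graph_tensor] at h
    exact h)
  (triangle := fun A B => by
    have h := congrArg (graph V Q).map (MonoidalCategory.triangle A.alg B.alg)
    simp only [← MonoidalCategory.tensorHom_id, ← MonoidalCategory.id_tensorHom,
      Functor.map_comp, ← graph_tensor] at h
    exact h)

lemma braiding_naturality {A B C D : SpanCat V Q} (f : A ⟶ B) (g : C ⟶ D) :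
    (f ⊗ₘ g) ≫ (graph V Q).map (β_ B.alg D.alg).hom =
      (graph V Q).map (β_ A.alg C.alg).hom ≫ (g ⊗ₘ f) := by
  obtain ⟨S⟩ := f
  obtain ⟨T⟩ := g
  have h : ∀ X Y : Alg E V, (β_ X Y).hom.hom = (β_ X.carrier Y.carrier).hom := fun X Y => by
    rw [← lift_snd_fst, ← lift_snd_fst]
    rfl
  refine Quotient.sound ?_
  change QSpan.Equiv (QSpan.comp _ (QSpan.graph _)) (QSpan.comp (QSpan.graph _) _)
  rw [h, h]
  exact QSpan.braiding_naturality S.1 T.1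

/-- The symmetry is the graph of the symmetry of the finite products of algebras. -/
instance : SymmetricCategory (SpanCat V Q) where
  braiding A B := (graph V Q).mapIso (β_ A.alg B.alg)
  braiding_naturality_right X _ _ f := braiding_naturality (𝟙 X) f
  braiding_naturality_left f Z := braiding_naturality f (𝟙 Z)
  hexagon_forward A B C := by
    have h := congrArg (graph V Q).map (BraidedCategory.hexagon_forward A.alg B.alg C.alg)
    simp only [← MonoidalCategory.tensorHom_id, ← MonoidalCategory.id_tensorHom,
      Functor.map_comp, ← graph_tensor] at h
    exact h
  hexagon_reverse A B C := by
    have h := congrArg (graph V Q).map (BraidedCategory.hexagon_reverse A.alg B.alg C.alg)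
    simp only [← MonoidalCategory.tensorHom_id, ← MonoidalCategory.id_tensorHom,
      Functor.map_comp, ← graph_tensor] at h
    exact h
  symmetry A B := by
    have h := congrArg (graph V Q).map (SymmetricCategory.symmetry A.alg B.alg)
    simp only [Functor.map_comp] at h
    exact h

end SpanCat

end SpanCat

end AlgQSpan

end

noncomputable section

namespace AlgQSpan

/-! ### Converses of `Q`-spans -/

namespace QSpan

variable {E : Type u} [Category.{v} E] [CartesianMonoidalCategory E]
  {Q A B C : E} [MonObj Q]

/-! The structure has three sources. First, algebras form a cartesian category, where diagonals and
maps to the terminal object make every object a cocommutative comonoid, compatibly with products.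
The graph functor preserves tensor, unit and coherence isomorphisms strictly (`graph_tensor`,
`graph_tensorμ`), so it carries every comonoid law and every coherence condition over to spans.

Second, taking converses is identity on objects, reverses composition (`converse_comp`), respects
tensors (`converse_tensor`), and sends the graph of an isomorphism to the graph of its inverse
(`converse_graph_iso`). Applied to the comonoid laws it yields the monoid laws and their coherence.

Third, the special and Frobenius axioms mix graphs with converses. They follow from the
Beck-Chevalley property `graph_comp_converse_graph`: a pullback square lets a graph followed by a
converse graph be traded for a converse graph followed by a graph. The characteristic morphisms do
not interfere, since on graphs they are constant at the unit of `Q`. What remains is three pullback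
squares of diagonals: the special axiom says that the diagonal is monic, and the Frobenius axiom
that `(a, b, b) = (c, c, d)`, or its mirror image, forces all the entries to agree. -/

lemma converse_comp [HasPullbacks E] [BraidedCategory E] [IsCommMonObj Q] (S : QSpan Q A B)
    (T : QSpan Q B C) :
    (S.comp T).converse.Equiv (T.converse.comp S.converse) := by
  obtain ⟨X, f, g, c⟩ := S
  obtain ⟨Y, f', g', c'⟩ := T
  have h := IsPullback.of_hasPullback g f'
  -- Reversing the order of composition swaps the two factors of the characteristic morphism, so
  -- commutativity of `Q` is essential here.
  exact (comp_equiv h).converse.trans (Equiv.trans (equiv_mk_eq rfl rfl (mul_comm _ _))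
    (comp_equiv h.flip).symm)

/-- The apexes differ, being `A` and `B`; `e` itself is the isomorphism of spans between them. -/
lemma converse_graph_iso (e : A ≅ B) :
    (graph (Q := Q) e.hom).converse.Equiv (graph e.inv) :=
  equiv_mk e (Category.comp_id _).symm e.hom_inv_id.symm (MonObj.comp_one e.hom).symm

/-- The Beck-Chevalley condition for graphs. -/
lemma graph_comp_converse_graph [HasPullbacks E] {P : E} {p : P ⟶ A} {q : P ⟶ B} {f : A ⟶ C}
    {g : B ⟶ C} (h : IsPullback p q f g) :
    ((graph (Q := Q) f).comp (graph g).converse).Equiv ((graph p).converse.comp (graph q)) := by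
  -- Both composites have apex `P` with legs `p` and `q`; the characteristic morphisms agree because
  -- `1 * 1 = 1`.
  refine (comp_equiv h).trans (Equiv.trans (equiv_mk_eq ?_ ?_ ?_) (comp_graph _ _ _ _).symm) <;>
    simp [MonObj.comp_one]

end QSpan

/-! ### Pullback squares of diagonals -/

section Diagonal

variable {E : Type u} [Category.{v} E] [CartesianMonoidalCategory E]

/-- The kernel pair of a monomorphism is trivial, and the diagonal is split by the first projection.
-/
lemma isPullback_diag (A : E) :
    IsPullback (𝟙 A) (𝟙 A) (lift (𝟙 A) (𝟙 A)) (lift (𝟙 A) (𝟙 A)) := by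
  refine ⟨⟨rfl⟩, ⟨PullbackCone.IsLimit.mk _ (fun s => s.fst) (fun s => by simp) (fun s => ?_)
    (fun s m h _ => by simpa using h)⟩⟩
  simpa using s.condition =≫ fst _ _

/-- On elements the cospan is `(a, b) ↦ ((a, b), b)` and `(c, d) ↦ ((c, c), d)`. Equality of the
images means `a = c`, `b = c` and `b = d`, so a single element of `A` determines both pairs. -/
lemma isPullback_diag_whiskerLeft (A : E) :
    IsPullback (lift (𝟙 A) (𝟙 A)) (lift (𝟙 A) (𝟙 A))
      (A ◁ lift (𝟙 A) (𝟙 A) ≫ (α_ A A A).inv) (lift (𝟙 A) (𝟙 A) ▷ A) := by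
  refine ⟨⟨by ext <;> simp⟩, ⟨PullbackCone.IsLimit.mk _ (fun s => s.fst ≫ fst _ _)
    (fun s => ?_) (fun s => ?_) (fun s m h _ => by simp [← h])⟩⟩
  all_goals
    -- The three coordinates of the cone condition are exactly these three equations.
    have h₁ := (s.condition =≫ fst _ _) =≫ fst _ _
    have h₂ := (s.condition =≫ fst _ _) =≫ snd _ _
    have h₃ := s.condition =≫ snd _ _
    simp at h₁ h₂ h₃
    ext <;> simp <;> grind

/-- The mirror image: `(a, (a, b)) = (c, (d, d))` forces `a = b = c = d`. -/
lemma isPullback_diag_whiskerRight (A : E) :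
    IsPullback (lift (𝟙 A) (𝟙 A)) (lift (𝟙 A) (𝟙 A))
      (lift (𝟙 A) (𝟙 A) ▷ A ≫ (α_ A A A).hom) (A ◁ lift (𝟙 A) (𝟙 A)) := by
  refine ⟨⟨by ext <;> simp⟩, ⟨PullbackCone.IsLimit.mk _ (fun s => s.snd ≫ fst _ _)
    (fun s => ?_) (fun s => ?_) (fun s m _ h => by simp [← h])⟩⟩
  all_goals
    have h₁ := s.condition =≫ fst _ _
    have h₂ := (s.condition =≫ snd _ _) =≫ fst _ _
    have h₃ := (s.condition =≫ snd _ _) =≫ snd _ _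
    simp at h₁ h₂ h₃
    ext <;> simp <;> grind

/-- Exchanging the two middle factors is undone by exchanging them again. This makes `tensorμ` an
isomorphism with an explicit inverse, as `converse_tensorμ` requires. -/
lemma tensorμ_comp_tensorμ [BraidedCategory E] (A B C D : E) :
    tensorμ A B C D ≫ tensorμ A C B D = 𝟙 _ := by
  ext <;> simp

lemma diag_tensor [BraidedCategory E] (A B : E) :
    lift (𝟙 (A ⊗ B)) (𝟙 (A ⊗ B)) =
      (lift (𝟙 A) (𝟙 A) ⊗ₘ lift (𝟙 B) (𝟙 B)) ≫ tensorμ A A B B := by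
  ext <;> simp

end Diagonal

/-! ### Converses in the category of algebraic `Q`-spans -/

namespace SpanCat

variable {E : Type u} [Category.{v} E] [CartesianMonoidalCategory E] [BraidedCategory E]
  [HasPullbacks E] {V : Variety.{w}} {Q : PoCommMon E}

lemma converse_comp {A B C : SpanCat V Q} (f : A ⟶ B) (g : B ⟶ C) :
    converse (f ≫ g) = converse g ≫ converse f := by
  obtain ⟨S⟩ := f
  obtain ⟨T⟩ := g
  exact Quotient.sound (QSpan.converse_comp S.1 T.1)

lemma converse_tensor {A B C D : SpanCat V Q} (f : A ⟶ B) (g : C ⟶ D) :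
    converse (f ⊗ₘ g) = converse f ⊗ₘ converse g := by
  obtain ⟨S⟩ := f
  obtain ⟨T⟩ := g
  rfl

lemma converse_graph_iso {A B : Alg E V} (e : A ≅ B) :
    converse ((graph V Q).map e.hom) = (graph V Q).map e.inv :=
  Quotient.sound (QSpan.converse_graph_iso ⟨e.hom.hom, e.inv.hom,
    congrArg Alg.Hom.hom e.hom_inv_id, congrArg Alg.Hom.hom e.inv_hom_id⟩)

lemma converse_id (A : SpanCat V Q) : converse (𝟙 A) = 𝟙 A := rfl

lemma converse_whiskerLeft (A : SpanCat V Q) {B C : SpanCat V Q} (f : B ⟶ C) :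
    converse (A ◁ f) = A ◁ converse f := by
  rw [← id_tensorHom, ← id_tensorHom, converse_tensor, converse_id]

lemma converse_whiskerRight {A B : SpanCat V Q} (f : A ⟶ B) (C : SpanCat V Q) :
    converse (f ▷ C) = converse f ▷ C := by
  rw [← tensorHom_id, ← tensorHom_id, converse_tensor, converse_id]

lemma whiskerLeft_graph (A : Alg E V) {B C : Alg E V} (f : B ⟶ C) :
    (graph V Q).obj A ◁ (graph V Q).map f = (graph V Q).map (A ◁ f) := by
  rw [← id_tensorHom, ← id_tensorHom, ← graph_tensor, CategoryTheory.Functor.map_id]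

lemma graph_whiskerRight {A B : Alg E V} (f : A ⟶ B) (C : Alg E V) :
    (graph V Q).map f ▷ (graph V Q).obj C = (graph V Q).map (f ▷ C) := by
  rw [← tensorHom_id, ← tensorHom_id, ← graph_tensor, CategoryTheory.Functor.map_id]

/-- The Beck-Chevalley condition for graphs of homomorphisms. -/
lemma graph_comp_converse_graph {P A B C : Alg E V} {p : P ⟶ A} {q : P ⟶ B} {f : A ⟶ C}
    {g : B ⟶ C} (h : IsPullback p.hom q.hom f.hom g.hom) :
    (graph V Q).map f ≫ converse ((graph V Q).map g) =
      converse ((graph V Q).map p) ≫ (graph V Q).map q :=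
  Quotient.sound (QSpan.graph_comp_converse_graph h)

/-- The interchange is built from associators, whiskerings and the symmetry. The associators and the
symmetry of spans are graphs by definition, so only the whiskerings need rewriting. -/
lemma graph_tensorμ (A B C D : Alg E V) :
    (graph V Q).map (tensorμ A B C D) =
      tensorμ ((graph V Q).obj A) ((graph V Q).obj B) ((graph V Q).obj C)
        ((graph V Q).obj D) := by
  simp only [tensorμ, Functor.map_comp, ← whiskerLeft_graph, ← graph_whiskerRight]
  rfl

/-- The interchange is the graph of an isomorphism, so its converse is the graph of the inverse,
which is again an interchange. -/
lemma converse_tensorμ (A B C D : SpanCat V Q) :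
    converse (tensorμ A B C D) = tensorμ A C B D := by
  have h := converse_graph_iso (Q := Q) ⟨tensorμ A.alg B.alg C.alg D.alg,
    tensorμ A.alg C.alg B.alg D.alg, tensorμ_comp_tensorμ _ _ _ _, tensorμ_comp_tensorμ _ _ _ _⟩
  dsimp only at h
  rw [graph_tensorμ, graph_tensorμ] at h
  exact h

/-! ### The hypergraph structure -/

/-- The discarding of an algebra: the graph of the homomorphism to the terminal algebra. -/
def discard (A : SpanCat V Q) : A ⟶ 𝟙_ (SpanCat V Q) := (graph V Q).map (toUnit A.alg)

/-- The copying of an algebra: the graph of the diagonal. -/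
def copy (A : SpanCat V Q) : A ⟶ A ⊗ A := (graph V Q).map (lift (𝟙 A.alg) (𝟙 A.alg))

/-! ### Comonoid laws, transported from the category of algebras -/

lemma copy_discard_left (A : SpanCat V Q) : copy A ≫ discard A ▷ A = (λ_ A).inv := by
  have h : lift (𝟙 A.alg) (𝟙 A.alg) ≫ toUnit A.alg ▷ A.alg = (λ_ A.alg).inv := by
    ext1 <;> simp
  have h' := congrArg (graph V Q).map h
  -- After this the equation in algebras is definitionally the one for spans, whose unitors are
  -- graphs by construction.
  rw [Functor.map_comp, ← graph_whiskerRight] at h'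
  exact h'

lemma copy_discard_right (A : SpanCat V Q) : copy A ≫ A ◁ discard A = (ρ_ A).inv := by
  have h : lift (𝟙 A.alg) (𝟙 A.alg) ≫ A.alg ◁ toUnit A.alg = (ρ_ A.alg).inv := by
    ext1 <;> simp
  have h' := congrArg (graph V Q).map h
  rw [Functor.map_comp, ← whiskerLeft_graph] at h'
  exact h'

lemma copy_assoc (A : SpanCat V Q) :
    copy A ≫ A ◁ copy A = copy A ≫ copy A ▷ A ≫ (α_ A A A).hom := by
  have h : lift (𝟙 A.alg) (𝟙 A.alg) ≫ A.alg ◁ lift (𝟙 A.alg) (𝟙 A.alg) =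
      lift (𝟙 A.alg) (𝟙 A.alg) ≫ lift (𝟙 A.alg) (𝟙 A.alg) ▷ A.alg ≫
        (α_ A.alg A.alg A.alg).hom := by ext1 <;> simp
  have h' := congrArg (graph V Q).map h
  simp only [Functor.map_comp, ← whiskerLeft_graph, ← graph_whiskerRight] at h'
  exact h'

lemma copy_comm (A : SpanCat V Q) : copy A ≫ (β_ A A).hom = copy A := by
  have h : lift (𝟙 A.alg) (𝟙 A.alg) ≫ (β_ A.alg A.alg).hom = lift (𝟙 A.alg) (𝟙 A.alg) := by
    ext1 <;> simp
  have h' := congrArg (graph V Q).map h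
  rw [Functor.map_comp] at h'
  exact h'

/-! ### Coherence of the comonoids with tensor and unit -/

lemma copy_tensor (A B : SpanCat V Q) :
    copy (A ⊗ B) = (copy A ⊗ₘ copy B) ≫ tensorμ A A B B := by
  have h := congrArg (graph V Q).map (diag_tensor A.alg B.alg)
  rw [Functor.map_comp, ← graph_tensor, graph_tensorμ] at h
  exact h

lemma discard_tensor (A B : SpanCat V Q) :
    discard (A ⊗ B) = (discard A ⊗ₘ discard B) ≫ (λ_ (𝟙_ (SpanCat V Q))).hom := by
  have h : toUnit (A.alg ⊗ B.alg) =
      (toUnit A.alg ⊗ₘ toUnit B.alg) ≫ (λ_ (𝟙_ (Alg E V))).hom := toUnit_unique _ _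
  have h' := congrArg (graph V Q).map h
  rw [Functor.map_comp, ← graph_tensor] at h'
  exact h'

lemma copy_unit : copy (𝟙_ (SpanCat V Q)) = (λ_ (𝟙_ (SpanCat V Q))).inv := by
  have h : lift (𝟙 (𝟙_ (Alg E V))) (𝟙 (𝟙_ (Alg E V))) = (λ_ (𝟙_ (Alg E V))).inv := by
    apply CartesianMonoidalCategory.hom_ext <;> exact toUnit_unique _ _
  exact congrArg (graph V Q).map h

lemma discard_unit : discard (𝟙_ (SpanCat V Q)) = 𝟙 (𝟙_ (SpanCat V Q)) := by
  have h : toUnit (𝟙_ (Alg E V)) = 𝟙 _ := toUnit_unique _ _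
  exact congrArg (graph V Q).map h

/-! ### The special and Frobenius axioms -/

lemma copy_comp_converse_copy (A : SpanCat V Q) : copy A ≫ converse (copy A) = 𝟙 A :=
  -- Beck-Chevalley leaves the converse of an identity followed by an identity, which is
  -- definitionally `𝟙 A ≫ 𝟙 A`.
  (graph_comp_converse_graph (p := 𝟙 A.alg) (q := 𝟙 A.alg)
    (isPullback_diag A.alg.carrier)).trans (Category.comp_id (𝟙 A))

lemma whiskerLeft_copy_comp_converse (A : SpanCat V Q) :
    A ◁ copy A ≫ (α_ A A A).inv ≫ converse (copy A) ▷ A = converse (copy A) ≫ copy A := by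
  -- The copying and the reassociation together are the graph of one homomorphism, and the final
  -- merging is a converse graph; so Beck-Chevalley applies, with both projections of the pullback
  -- equal to the diagonal.
  have h := graph_comp_converse_graph (Q := Q) (p := lift (𝟙 A.alg) (𝟙 A.alg))
    (q := lift (𝟙 A.alg) (𝟙 A.alg)) (f := A.alg ◁ lift (𝟙 A.alg) (𝟙 A.alg) ≫ (α_ _ _ _).inv)
    (g := lift (𝟙 A.alg) (𝟙 A.alg) ▷ A.alg) (isPullback_diag_whiskerLeft A.alg.carrier)
  rw [Functor.map_comp, ← whiskerLeft_graph, ← graph_whiskerRight] at h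
  rw [← converse_whiskerRight, ← Category.assoc]
  exact h

lemma copy_whiskerRight_comp_converse (A : SpanCat V Q) :
    copy A ▷ A ≫ (α_ A A A).hom ≫ A ◁ converse (copy A) = converse (copy A) ≫ copy A := by
  have h := graph_comp_converse_graph (Q := Q) (p := lift (𝟙 A.alg) (𝟙 A.alg))
    (q := lift (𝟙 A.alg) (𝟙 A.alg)) (f := lift (𝟙 A.alg) (𝟙 A.alg) ▷ A.alg ≫ (α_ _ _ _).hom)
    (g := A.alg ◁ lift (𝟙 A.alg) (𝟙 A.alg)) (isPullback_diag_whiskerRight A.alg.carrier)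
  rw [Functor.map_comp, ← whiskerLeft_graph, ← graph_whiskerRight] at h
  rw [← converse_whiskerLeft, ← Category.assoc]
  exact h

/-! ### Converses of the coherence isomorphisms -/

lemma converse_associator_hom (A B C : SpanCat V Q) :
    converse (α_ A B C).hom = (α_ A B C).inv := converse_graph_iso (α_ A.alg B.alg C.alg)

lemma converse_leftUnitor_hom (A : SpanCat V Q) : converse (λ_ A).hom = (λ_ A).inv :=
  converse_graph_iso (λ_ A.alg)

lemma converse_leftUnitor_inv (A : SpanCat V Q) : converse (λ_ A).inv = (λ_ A).hom :=
  converse_graph_iso (λ_ A.alg).symm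

lemma converse_rightUnitor_inv (A : SpanCat V Q) : converse (ρ_ A).inv = (ρ_ A).hom :=
  converse_graph_iso (ρ_ A.alg).symm

lemma converse_braiding_hom (A B : SpanCat V Q) : converse (β_ A B).hom = (β_ A B).inv :=
  converse_graph_iso (β_ A.alg B.alg)

/-- The comonoid of copying and discarding. -/
abbrev comonObj (A : SpanCat V Q) : ComonObj A where
  counit := discard A
  comul := copy A
  counit_comul := copy_discard_left A
  comul_counit := copy_discard_right A
  comul_assoc := copy_assoc A

/-- The monoid of the converses of copying and discarding. -/
abbrev monObj (A : SpanCat V Q) : MonObj A where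
  one := converse (discard A)
  mul := converse (copy A)
  one_mul := by
    rw [← converse_whiskerRight, ← converse_comp, copy_discard_left, converse_leftUnitor_inv]
  mul_one := by
    rw [← converse_whiskerLeft, ← converse_comp, copy_discard_right, converse_rightUnitor_inv]
  mul_assoc := by
    -- The converse of coassociativity has the inverse associator on one side; cancelling it against
    -- the associator gives associativity.
    have h := congrArg converse (copy_assoc A)
    simp only [converse_comp, converse_whiskerLeft, converse_whiskerRight,
      converse_associator_hom, Category.assoc] at h
    rw [h, Iso.hom_inv_id_assoc]

variable (V Q) in
/-- The hypergraph structure given by copying, discarding and their converses. -/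
def hypergraphStructure : HypergraphStructure (SpanCat V Q) where
  mon := monObj
  mon_comm A := by
    let := monObj A
    refine ⟨?_⟩
    have h := congrArg converse (copy_comm A)
    rw [converse_comp, converse_braiding_hom, Iso.inv_comp_eq] at h
    exact h.symm
  comon := comonObj
  comon_comm A := by
    let := comonObj A
    exact ⟨copy_comm A⟩
  frobenius_left := whiskerLeft_copy_comp_converse
  frobenius_right := copy_whiskerRight_comp_converse
  special := copy_comp_converse_copy
  comul_tensor := copy_tensor
  counit_tensor := discard_tensor
  mul_tensor A B := by
    refine (congrArg converse (copy_tensor A B)).trans ?_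
    -- The converse of `tensorμ A A B B` is `tensorμ A B A B`, which is the index order required on
    -- the monoid side.
    rw [converse_comp, converse_tensor, converse_tensorμ]
    rfl
  one_tensor A B := by
    refine (congrArg converse (discard_tensor A B)).trans ?_
    rw [converse_comp, converse_tensor, converse_leftUnitor_hom]
    rfl
  comul_unit := copy_unit
  counit_unit := discard_unit
  mul_unit := (congrArg converse copy_unit).trans (converse_leftUnitor_inv _)
  one_unit := congrArg converse discard_unit

end SpanCat

end AlgQSpan

end

theorem mainTheorem2 {E : Type u} [Category.{v} E] [CartesianMonoidalCategory E]
    [BraidedCategory E] [HasFiniteLimits E] [MonoidalClosed E] [HasSubobjectClassifier E]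
    (V : AlgQSpan.Variety.{w}) (Q : AlgQSpan.PoCommMon E) :
    ∃ H : AlgQSpan.HypergraphStructure (AlgQSpan.SpanCat V Q), ∀ A : AlgQSpan.Alg E V,
      (H.comon ⟨A⟩).counit = (AlgQSpan.SpanCat.graph V Q).map (toUnit A) ∧
      (H.comon ⟨A⟩).comul = (AlgQSpan.SpanCat.graph V Q).map (lift (𝟙 A) (𝟙 A)) ∧
      (H.mon ⟨A⟩).one =
        AlgQSpan.SpanCat.converse ((AlgQSpan.SpanCat.graph V Q).map (toUnit A)) ∧
      (H.mon ⟨A⟩).mul =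
        AlgQSpan.SpanCat.converse ((AlgQSpan.SpanCat.graph V Q).map (lift (𝟙 A) (𝟙 A))) :=
  ⟨AlgQSpan.SpanCat.hypergraphStructure V Q, fun _ => ⟨rfl, rfl, rfl, rfl⟩⟩
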